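/- Let $t\ge 2$ and let $q$ be a probability mass function on $\mathcal X^t$, with $\mathcal X$ a finite set, such that $(X_1,\dots,X_t)\sim q$ satisfies $X_1=\dots=X_t=X$ almost surely; let $H(X)$ be the Shannon entropy of $X$ in bits. In the individually shared randomness model with an omniscient coordinator there are independent random variables $W_1,\dots,W_t$, with $W_i$ uniform on $[1:2^{nR_i}]$ (here $[1:a]=\{1,\dots,\lfloor a\rfloor\}$). A coordinator observes all of $W_1,\dots,W_t$ and sends a message $M\in[1:2^{nR}]$, drawn from a conditional p.m.f. $p(m\mid w_1,\dots,w_t)$, to all $t$ processors; processor $i$ observes only $(M,W_i)$ and outputs $X_i^n\in\mathcal X^n$ drawn from a conditional p.m.f. $p(x_i^n\mid m,w_i)$, so that the induced output distribution is $$p(x_1^n,\dots,x_t^n)=\sum_{w_1,\dots,w_t}\sum_m \Big(\prod_{i=1}^t\frac1{\lfloor 2^{nR_i}\rfloor}\Big)\,p(m\mid w_1,\dots,w_t)\prod_{i=1}^t p(x_i^n\mid m,w_i).$$ A tuple $(R,R_1,\dots,R_t)$ of non-negative reals is achievable for $q$ if there is a sequence, over $n$, of such codes with $\lim_{n\to\infty}\big\|p_{X_1^n,\dots,X_t^n}-q^{(n)}\big\|_1=0$,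 where $q^{(n)}(x_1^n,\dots,x_t^n)=\prod_{k=1}^n q(x_{1k},\dots,x_{tk})$. The simulation rate region $\mathcal R^{\mathrm{Indv}}$ is the closure of the set of achievable tuples. Theorem. $\mathcal R^{\mathrm{Indv}}$ is exactly the set of all non-negative tuples $(R,R_1,\dots,R_t)$ such that $$R+\min\{R_1,\dots,R_t\}\ \ge\ H(X)\qquad\text{and}\qquad R\ \ge\ \frac{(t-1)H(X)}{t}.$$ -/

import Mathlib

open scoped BigOperators

/-- The number of elements of `[1 : 2^{nR}]`, i.e. of integers `m` with `1 ≤ m ≤ 2^{nR}`. -/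
noncomputable def indexSize (n : ℕ) (R : ℝ) : ℕ := ⌊(2 : ℝ) ^ ((n : ℝ) * R)⌋₊

/-- A simulation code of block length `n` for `t` processors and `h` sources of randomness, where
processor `i` has access to the sources with index in `V i`, the message takes `K` values and the
`j`-th source takes `L j` values. It consists of the random map of the coordinator (which sees all
the sources) and the random maps of the processors (processor `i` sees the message and the sources
in `V i`). -/
structure SimulationCode {t h : ℕ} (V : Fin t → Finset (Fin h)) (A : Fin t → Type*)
    (n K : ℕ) (L : Fin h → ℕ) where
  coordinator : (∀ j : Fin h, Fin (L j)) → PMF (Fin K)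
  processor : ∀ i : Fin t, Fin K → (∀ j : V i, Fin (L j)) → PMF (Fin n → A i)

/-- The distribution of `(X₁ⁿ, …, X_tⁿ)` induced by a simulation code, when the sources are
independent and the `j`-th one is uniform on its `L j` values. -/
noncomputable def SimulationCode.induced {t h : ℕ} {V : Fin t → Finset (Fin h)}
    {A : Fin t → Type*} {n K : ℕ} {L : Fin h → ℕ} (c : SimulationCode V A n K L)
    (x : ∀ i : Fin t, Fin n → A i) : ℝ :=
  ∑ w : (∀ j : Fin h, Fin (L j)), ∑ m : Fin K,
    (c.coordinator w m).toReal *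
      (∏ i : Fin t, (c.processor i m (fun j => w j) (x i)).toReal) / ∏ j : Fin h, (L j : ℝ)

/-- The `n`-fold i.i.d. extension of the joint p.m.f. `q`. -/
noncomputable def iidLaw {t : ℕ} {A : Fin t → Type*} (q : PMF (∀ i, A i)) (n : ℕ)
    (x : ∀ i : Fin t, Fin n → A i) : ℝ :=
  ∏ k : Fin n, (q (fun i => x i k)).toReal

/-- The rate tuple `(R, R₁, …, R_h)` is achievable for the p.m.f. `q`: there is a sequence of
`(n, 2^{nR}, 2^{nR₁}, …, 2^{nR_h})` simulation codes whose induced distribution approaches the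
i.i.d. one in total variation. Rates are non-negative. -/
def IsAchievable {t h : ℕ} (V : Fin t → Finset (Fin h)) {A : Fin t → Type*}
    [∀ i, Fintype (A i)] (q : PMF (∀ i, A i)) (R : ℝ) (Rs : Fin h → ℝ) : Prop :=
  0 ≤ R ∧ (∀ j, 0 ≤ Rs j) ∧
    ∃ c : ∀ n : ℕ, SimulationCode V A n (indexSize n R) (fun j => indexSize n (Rs j)),
      Filter.Tendsto
        (fun n : ℕ => ∑ x : (∀ i : Fin t, Fin n → A i), |(c n).induced x - iidLaw q n x|)
        Filter.atTop (nhds 0)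

/-- The simulation rate region: the closure of the set of achievable rate tuples
`(R, (R₁, …, R_h))`. -/
def simulationRegion {t h : ℕ} (V : Fin t → Finset (Fin h)) {A : Fin t → Type*}
    [∀ i, Fintype (A i)] (q : PMF (∀ i, A i)) : Set (ℝ × (Fin h → ℝ)) :=
  closure {r : ℝ × (Fin h → ℝ) | IsAchievable V q r.1 r.2}

/-- The individually shared randomness model: `h = t` and processor `i` has access exactly to the
`i`-th source. -/
def individualAccess (t : ℕ) : Fin t → Finset (Fin t) := fun i => {i}

/-- The Shannon entropy, in bits, of a p.m.f. on a finite set. -/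
noncomputable def entropyBits {α : Type*} [Fintype α] (p : PMF α) : ℝ :=
  -∑ a : α, (p a).toReal * Real.logb 2 (p a).toReal

/-! Write Q for the `n`-fold law of X, which is where the target lives (on the diagonal). If c <
H(X), almost no Q-mass exceeds the cap b = 2^(-nc), so a code close to the target needs ∑_y min(b,
P(y,…,y)) close to 1 (`one_le_sum_max_add_sum_min_add`). Both converse bounds come from estimating
this capped sum for an arbitrary code. Message bound: discarding the coordinator's probabilities
leaves P(y,…,y) ≤ ∑_m ∏_i a_i(m,y), where each a_i(m,·) is a p.m.f. Interpolating with weight 1/t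
and applying AM-GM gives at most b^(1-1/t)·K, hence R ≥ (1-1/t)H(X). Observation bound: processor i
sees only K·L_i values, and Cauchy–Schwarz against the joint law of its observation and another
processor's output gives at most √(b·K·L_i), hence R + R_i ≥ H(X). Achievability: hash every source
to a nearly uniform element g_j of a group G of size about 2^(na). Sending the t-1 differences g_j -
g_{i₀} lets every processor recover all of g_1,…,g_t from its own source, so (t-1)a bits per symbol
of message yield ta bits of common randomness. The rest of the message carries b fresh uniform bits
per symbol. A common function of nearly uniform randomness simulates Q as soon as ta + b > H(X); the
choice a = min(min_i R_i, H(X)/t) reaches every point of the region up to ε. -/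

theorem PMF.sum_toReal_eq_one {β : Type*} [Fintype β] (p : PMF β) :
    ∑ b, (p b).toReal = 1 := by
  rw [← ENNReal.toReal_sum (fun b _ => p.apply_ne_top b), ← tsum_fintype (L := .unconditional β),
    p.tsum_coe, ENNReal.toReal_one]

theorem PMF.toReal_apply_le_one {β : Type*} (p : PMF β) (b : β) : (p b).toReal ≤ 1 :=
  ENNReal.toReal_mono ENNReal.one_ne_top (p.coe_le_one b)

/-! ### Entropy as a threshold exponent for product laws -/

/-- The case u = 0 is separate: the exponent stays positive near s = 0, so the function is locally
zero, in agreement with the convention 0 log 0 = 0. -/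
theorem hasDerivAt_rpow_one_add {u : ℝ} (hu : 0 ≤ u) :
    HasDerivAt (fun s : ℝ => u ^ (1 + s)) (u * Real.log u) 0 := by
  rcases hu.eq_or_lt with rfl | hu
  · have h : (fun s : ℝ => (0 : ℝ) ^ (1 + s)) =ᶠ[nhds 0] fun _ => 0 := by
      filter_upwards [lt_mem_nhds (show (-1 : ℝ) < 0 by norm_num)] with s hs
      exact Real.zero_rpow (by linarith)
    simpa using (hasDerivAt_const (0 : ℝ) (0 : ℝ)).congr_of_eventuallyEq h
  · have h := ((hasDerivAt_id (0 : ℝ)).const_add 1).const_rpow hu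
    simpa [mul_comm] using h

section Entropy

variable {α : Type*} [Fintype α]

/-- The sum equals 1 at s = 0, so the sign of c - H(X) decides on which side of 0 it drops below 1.
This is the Chernoff exponent behind both tail estimates. -/
theorem hasDerivAt_sum_rpow (p : PMF α) (c : ℝ) :
    HasDerivAt (fun s : ℝ => ∑ a, (p a).toReal ^ (1 + s) * (2 : ℝ) ^ (s * c))
      (Real.log 2 * (c - entropyBits p)) 0 := by
  have h2 : HasDerivAt (fun s : ℝ => (2 : ℝ) ^ (s * c)) (c * Real.log 2) 0 := by
    have h := ((hasDerivAt_id (0 : ℝ)).mul_const c).const_rpow (a := 2) (by norm_num)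
    simpa [mul_comm] using h
  have h := HasDerivAt.fun_sum (u := Finset.univ) fun (a : α) _ =>
    (hasDerivAt_rpow_one_add (ENNReal.toReal_nonneg (a := p a))).mul h2
  refine h.congr_deriv ?_
  have hl : Real.log 2 ≠ 0 := (Real.log_pos (by norm_num)).ne'
  simp only [zero_mul, Real.rpow_zero, mul_one, add_zero, Real.rpow_one, Finset.sum_add_distrib,
    ← Finset.sum_mul, p.sum_toReal_eq_one, entropyBits, Real.logb]
  rw [sub_neg_eq_add, mul_add, Finset.mul_sum, add_comm, one_mul, mul_comm c]
  congr 1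
  refine Finset.sum_congr rfl fun a _ => ?_
  field_simp

theorem exists_sum_rpow_lt_one_of_lt_entropyBits (p : PMF α) {c : ℝ} (hc : c < entropyBits p) :
    ∃ s : ℝ, 0 < s ∧ ∑ a, (p a).toReal ^ (1 + s) * (2 : ℝ) ^ (s * c) < 1 := by
  have h := hasDerivAt_iff_tendsto_slope.1 (hasDerivAt_sum_rpow p c)
  have hneg : Real.log 2 * (c - entropyBits p) < 0 :=
    mul_neg_of_pos_of_neg (Real.log_pos (by norm_num)) (by linarith)
  have h' := (h.eventually_lt_const hneg).filter_mono
    (nhdsWithin_mono (0 : ℝ) (fun x (hx : x ∈ Set.Ioi (0 : ℝ)) => (Set.mem_Ioi.1 hx).ne'))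
  obtain ⟨s, hs, hs0⟩ := (h'.and self_mem_nhdsWithin).exists
  refine ⟨s, hs0, ?_⟩
  rw [slope_def_field] at hs
  have hs0 : 0 < s := hs0
  have := (div_lt_iff₀ (by linarith : 0 < s - 0)).1 hs
  simp only [add_zero, Real.rpow_one, zero_mul, Real.rpow_zero, mul_one, p.sum_toReal_eq_one] at this
  linarith

theorem exists_sum_rpow_lt_one_of_entropyBits_lt (p : PMF α) {c : ℝ} (hc : entropyBits p < c) :
    ∃ s : ℝ, 0 < s ∧ s < 1 ∧ ∑ a, (p a).toReal ^ (1 - s) * (2 : ℝ) ^ (-s * c) < 1 := by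
  have h := hasDerivAt_iff_tendsto_slope.1 (hasDerivAt_sum_rpow p c)
  have hpos : 0 < Real.log 2 * (c - entropyBits p) :=
    mul_pos (Real.log_pos (by norm_num)) (by linarith)
  have h' := (h.eventually_const_lt hpos).filter_mono
    (nhdsWithin_mono (0 : ℝ) (fun x (hx : x ∈ Set.Iio (0 : ℝ)) => (Set.mem_Iio.1 hx).ne))
  -- After the sign change this gives s < 1, so that 1 - s and s can serve as interpolation weights.
  have h1 : ∀ᶠ s : ℝ in nhdsWithin 0 (Set.Iio 0), -1 < s :=
    (lt_mem_nhds (by norm_num)).filter_mono nhdsWithin_le_nhds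
  obtain ⟨s, ⟨hs, hs1⟩, hs0⟩ := ((h'.and h1).and self_mem_nhdsWithin).exists
  have hs0 : s < 0 := hs0
  refine ⟨-s, by linarith, by linarith, ?_⟩
  rw [slope_def_field] at hs
  have : 0 < (s - 0) * (((∑ a, (p a).toReal ^ (1 + s) * (2 : ℝ) ^ (s * c)) -
      ∑ a, (p a).toReal ^ (1 + 0 : ℝ) * (2 : ℝ) ^ (0 * c)) / (s - 0)) * (-1) := by
    nlinarith
  rw [mul_div_cancel₀ _ (by linarith)] at this
  simp only [add_zero, Real.rpow_one, zero_mul, Real.rpow_zero, mul_one, p.sum_toReal_eq_one] at this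
  simp only [sub_neg_eq_add, neg_neg]
  linarith

/-- The `n`-fold product of a p.m.f., as a real-valued function. -/
noncomputable def prodLaw {α : Type*} (p : PMF α) (n : ℕ) (y : Fin n → α) : ℝ := ∏ k, (p (y k)).toReal

theorem prodLaw_nonneg {α : Type*} (p : PMF α) (n : ℕ) (y : Fin n → α) : 0 ≤ prodLaw p n y :=
  Finset.prod_nonneg fun _ _ => ENNReal.toReal_nonneg

theorem sum_prodLaw (p : PMF α) (n : ℕ) : ∑ y, prodLaw p n y = 1 := by
  simp only [prodLaw]
  rw [← Fintype.sum_pow (fun a => (p a).toReal) n, p.sum_toReal_eq_one, one_pow]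

theorem sum_prodLaw_rpow_mul (p : PMF α) (n : ℕ) (u v c : ℝ) :
    ∑ y, prodLaw p n y ^ u * ((2 : ℝ) ^ (-(n * c))) ^ v =
      (∑ a, (p a).toReal ^ u * (2 : ℝ) ^ (-v * c)) ^ n := by
  rw [Fintype.sum_pow (fun a => (p a).toReal ^ u * (2 : ℝ) ^ (-v * c)) n]
  refine Finset.sum_congr rfl fun y _ => ?_
  rw [Finset.prod_mul_distrib, Finset.prod_const, Finset.card_univ, Fintype.card_fin, prodLaw,
    Real.finsetProd_rpow _ _ (fun _ _ => ENNReal.toReal_nonneg), ← Real.rpow_natCast,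
    ← Real.rpow_mul (by norm_num), ← Real.rpow_mul (by norm_num)]
  congr 2
  ring

/-- Where Q ≥ b the excess is at most Q·(Q/b)^s, and the sum of these over y is the `n`-th power of
a one-letter sum below 1. -/
theorem tendsto_sum_max_prodLaw_sub (p : PMF α) {c : ℝ} (hc : c < entropyBits p) :
    Filter.Tendsto (fun n : ℕ => ∑ y, max (prodLaw p n y - (2 : ℝ) ^ (-(n * c))) 0)
      Filter.atTop (nhds 0) := by
  obtain ⟨s, hs0, hs⟩ := exists_sum_rpow_lt_one_of_lt_entropyBits p hc
  refine squeeze_zero (fun n => Finset.sum_nonneg fun y _ => le_max_right _ _) (fun n => ?_)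
    (tendsto_pow_atTop_nhds_zero_of_lt_one
      (Finset.sum_nonneg fun a _ => by positivity) hs)
  have h := sum_prodLaw_rpow_mul p n (1 + s) (-s) c
  rw [neg_neg] at h
  rw [← h]
  refine Finset.sum_le_sum fun y _ => ?_
  have hb : (0 : ℝ) < (2 : ℝ) ^ (-(n * c)) := by positivity
  have hq := prodLaw_nonneg p n y
  set b := (2 : ℝ) ^ (-(n * c))
  set Q := prodLaw p n y
  refine max_le ?_ (by positivity)
  rcases le_total Q b with hqb | hqb
  · exact (sub_nonpos.2 hqb).trans (by positivity)
  · have hQ : 0 < Q := hb.trans_le hqb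
    have : 1 ≤ (Q / b) ^ s := Real.one_le_rpow ((one_le_div hb).2 hqb) hs0.le
    rw [Real.rpow_add hQ, Real.rpow_one, Real.rpow_neg hb.le, mul_assoc, ← div_eq_mul_inv,
      ← Real.div_rpow hq hb.le]
    nlinarith

theorem min_le_rpow_mul_rpow {a b s : ℝ} (ha : 0 ≤ a) (hb : 0 ≤ b) (hs0 : 0 ≤ s) (hs1 : s ≤ 1) :
    min a b ≤ a ^ (1 - s) * b ^ s := by
  have h0 : 0 ≤ min a b := le_min ha hb
  calc min a b = min a b ^ (1 - s) * min a b ^ s := by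
        rw [← Real.rpow_add_of_nonneg h0 (by linarith) hs0]; simp
    _ ≤ a ^ (1 - s) * b ^ s := mul_le_mul (Real.rpow_le_rpow h0 (min_le_left _ _) (by linarith))
          (Real.rpow_le_rpow h0 (min_le_right _ _) hs0) (by positivity) (by positivity)

/-- Interpolation bounds the minimum by Q^(1-s)·b^s, whose sum is again the `n`-th power of a number
below 1. -/
theorem tendsto_sum_min_prodLaw (p : PMF α) {c : ℝ} (hc : entropyBits p < c) :
    Filter.Tendsto (fun n : ℕ => ∑ y, min (prodLaw p n y) ((2 : ℝ) ^ (-(n * c))))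
      Filter.atTop (nhds 0) := by
  obtain ⟨s, hs0, hs1, hs⟩ := exists_sum_rpow_lt_one_of_entropyBits_lt p hc
  refine squeeze_zero
    (fun n => Finset.sum_nonneg fun y _ => le_min (prodLaw_nonneg p n y) (by positivity))
    (fun n => ?_)
    (tendsto_pow_atTop_nhds_zero_of_lt_one
      (Finset.sum_nonneg fun a _ => by positivity) hs)
  rw [← sum_prodLaw_rpow_mul p n (1 - s) s c]
  exact Finset.sum_le_sum fun y _ =>
    min_le_rpow_mul_rpow (prodLaw_nonneg p n y) (by positivity) hs0.le hs1.le

end Entropy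

/-! ### Converse estimates for a single code -/

theorem min_sum_le_sum_min {ι : Type*} (s : Finset ι) {b : ℝ} (hb : 0 ≤ b) {f : ι → ℝ}
    (hf : ∀ i ∈ s, 0 ≤ f i) : min b (∑ i ∈ s, f i) ≤ ∑ i ∈ s, min b (f i) := by
  classical
  by_cases h : ∃ i ∈ s, b ≤ f i
  · obtain ⟨i, hi, hbi⟩ := h
    calc min b (∑ i ∈ s, f i) ≤ min b (f i) := by rw [min_eq_left hbi]; exact min_le_left _ _
      _ ≤ _ := Finset.single_le_sum (f := fun i => min b (f i))
        (fun j hj => le_min hb (hf j hj)) hi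
  · push Not at h
    exact (min_le_right _ _).trans_eq
      (Finset.sum_congr rfl fun i hi => (min_eq_right (h i hi).le).symm)

namespace SimulationCode

section

variable {t n K : ℕ} {α : Type*} {L : Fin t → ℕ}

/-- The random map of processor `i`, as a function of the message and of its own source. -/
noncomputable def kernel (c : SimulationCode (individualAccess t) (fun _ => α) n K L)
    (i : Fin t) (m : Fin K) (v : Fin (L i)) : PMF (Fin n → α) :=
  c.processor i m fun j => Fin.cast (congrArg L (Finset.mem_singleton.1 j.2).symm) v

theorem processor_eq_kernel (c : SimulationCode (individualAccess t) (fun _ => α) n K L)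
    (i : Fin t) (m : Fin K) (w : ∀ j, Fin (L j)) :
    c.processor i m (fun j => w j) = c.kernel i m (w i) := by
  unfold kernel
  congr 1
  funext ⟨j, hj⟩
  obtain rfl : j = i := Finset.mem_singleton.1 hj
  rfl

theorem induced_eq (c : SimulationCode (individualAccess t) (fun _ => α) n K L)
    (x : Fin t → Fin n → α) :
    c.induced x = ∑ w, ∑ m, (c.coordinator w m).toReal *
      (∏ i, (c.kernel i m (w i) (x i)).toReal) / ∏ j, (L j : ℝ) := by
  simp only [induced, processor_eq_kernel]

theorem induced_nonneg (c : SimulationCode (individualAccess t) (fun _ => α) n K L)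
    (x : Fin t → Fin n → α) : 0 ≤ c.induced x :=
  Finset.sum_nonneg fun _ _ => Finset.sum_nonneg fun _ _ => by positivity

/-- Bounding the coordinator's probability by 1 removes the only coupling between the sources, so
the sum over source tuples factors over the processors. -/
theorem induced_diag_le_sum_prod (c : SimulationCode (individualAccess t) (fun _ => α) n K L)
    (y : Fin n → α) : c.induced (fun _ => y) ≤
      ∑ m, ∏ i, ∑ v, (c.kernel i m v y).toReal / L i := by
  classical
  rw [induced_eq, Finset.sum_comm]
  refine Finset.sum_le_sum fun m _ => ?_
  have h := Finset.prod_univ_sum (fun i : Fin t => (Finset.univ : Finset (Fin (L i))))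
    fun i v => (c.kernel i m v y).toReal / (L i : ℝ)
  rw [Fintype.piFinset_univ] at h
  rw [h]
  refine Finset.sum_le_sum fun w _ => ?_
  rw [Finset.prod_div_distrib]
  gcongr
  exact mul_le_of_le_one_left (Finset.prod_nonneg fun _ _ => ENNReal.toReal_nonneg)
    (PMF.toReal_apply_le_one _ _)

end

variable {t n K : ℕ} {α : Type*} [Fintype α] {L : Fin t → ℕ}

theorem sum_div_prod_eq_one {L : Fin t → ℕ} (hL : ∀ i, 0 < L i) :
    ∑ _w : (∀ j, Fin (L j)), 1 / ∏ j, (L j : ℝ) = 1 := by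
  have : ∏ j, (L j : ℝ) ≠ 0 := Finset.prod_ne_zero_iff.2 fun i _ => by
    exact_mod_cast (hL i).ne'
  simp [Fintype.card_pi, this]

theorem sum_induced (c : SimulationCode (individualAccess t) (fun _ => α) n K L)
    (hL : ∀ i, 0 < L i) : ∑ x : Fin t → Fin n → α, c.induced x = 1 := by
  classical
  simp only [induced_eq]
  rw [Finset.sum_comm, ← sum_div_prod_eq_one hL]
  refine Finset.sum_congr rfl fun w _ => ?_
  rw [Finset.sum_comm, ← (c.coordinator w).sum_toReal_eq_one, Finset.sum_div]
  refine Finset.sum_congr rfl fun m _ => ?_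
  rw [← Finset.sum_div, ← Finset.mul_sum]
  have h := Finset.prod_univ_sum (fun _ : Fin t => (Finset.univ : Finset (Fin n → α)))
    fun i y => (c.kernel i m (w i) y).toReal
  rw [Fintype.piFinset_univ] at h
  rw [← h]
  simp [PMF.sum_toReal_eq_one]

/-- The probability that all outputs agree, up to a cap `b` on the individual probabilities,
is limited by the number of messages. -/
theorem sum_min_induced_le_message (c : SimulationCode (individualAccess t) (fun _ => α) n K L)
    (ht : 0 < t) (hL : ∀ i, 0 < L i) {b : ℝ} (hb : 0 ≤ b) :
    ∑ y : Fin n → α, min b (c.induced fun _ => y) ≤ b ^ (1 - 1 / (t : ℝ)) * K := by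
  have ht' : (1 : ℝ) ≤ t := by exact_mod_cast ht
  set a : Fin K → (Fin n → α) → Fin t → ℝ :=
    fun m y i => ∑ v, (c.kernel i m v y).toReal / L i with ha
  have ha0 : ∀ m y i, 0 ≤ a m y i := fun m y i => Finset.sum_nonneg fun _ _ => by positivity
  have hmean : ∀ m y, (∏ i, a m y i) ^ (1 / (t : ℝ)) ≤ ∑ i, 1 / (t : ℝ) * a m y i := by
    intro m y
    have h := Real.geom_mean_le_arith_mean_weighted Finset.univ (fun _ : Fin t => 1 / (t : ℝ))
      (a m y) (fun _ _ => by positivity) (by simp; field_simp) (fun i _ => ha0 m y i)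
    rwa [Real.finsetProd_rpow _ _ fun i _ => ha0 m y i] at h
  have hsum : ∀ m, ∑ y, ∑ i, 1 / (t : ℝ) * a m y i = 1 := by
    intro m
    rw [Finset.sum_comm]
    have : ∀ i, ∑ y, 1 / (t : ℝ) * a m y i = 1 / (t : ℝ) := by
      intro i
      have hLi : (L i : ℝ) ≠ 0 := by exact_mod_cast (hL i).ne'
      rw [← Finset.mul_sum, ha, Finset.sum_comm]
      simp only [← Finset.sum_div, PMF.sum_toReal_eq_one]
      simp [hLi]
    rw [Finset.sum_congr rfl fun i _ => this i]
    simp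
    field_simp
  calc ∑ y : Fin n → α, min b (c.induced fun _ => y)
      ≤ ∑ y : Fin n → α, ∑ m, b ^ (1 - 1 / (t : ℝ)) * ∑ i, 1 / (t : ℝ) * a m y i := by
        refine Finset.sum_le_sum fun y _ => ?_
        refine (min_le_min_left b (c.induced_diag_le_sum_prod y)).trans ?_
        refine (min_sum_le_sum_min _ hb fun m _ => Finset.prod_nonneg fun i _ => ha0 m y i).trans ?_
        refine Finset.sum_le_sum fun m _ => ?_
        -- The weight 1/t turns the product of `t` factors into a geometric mean, and the arithmetic
        -- mean that dominates it sums to 1 over y.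
        refine (min_le_rpow_mul_rpow hb (Finset.prod_nonneg fun i _ => ha0 m y i)
          (s := 1 / (t : ℝ)) (by positivity) ((div_le_one (by linarith)).2 ht')).trans ?_
        gcongr
        exact hmean m y
    _ = b ^ (1 - 1 / (t : ℝ)) * K := by
        rw [Finset.sum_comm]
        rw [Finset.sum_congr rfl fun m _ => show ∑ y, b ^ (1 - 1 / (t : ℝ)) *
          ∑ i, 1 / (t : ℝ) * a m y i = b ^ (1 - 1 / (t : ℝ)) by
            rw [← Finset.mul_sum, hsum, mul_one]]
        simp [mul_comm]

/-- The probability that all outputs agree, up to a cap `b` on the individual probabilities,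
is limited by the number of values of the observation of a processor. -/
theorem sum_min_induced_le_observation
    (c : SimulationCode (individualAccess t) (fun _ => α) n K L)
    (hL : ∀ i, 0 < L i) {i j : Fin t} (hij : i ≠ j) {b : ℝ} (hb : 0 ≤ b) :
    ∑ y : Fin n → α, min b (c.induced fun _ => y) ≤ √(b * (K * L i)) := by
  classical
  -- `g` is the joint law of the output of processor `j` and the observation (message, own source)
  -- of processor `i`.
  set g : (Fin n → α) → Fin K × Fin (L i) → ℝ := fun y u =>
    ∑ w : (∀ j, Fin (L j)), if w i = u.2 then
      (c.coordinator w u.1).toReal * (c.kernel j u.1 (w j) y).toReal / ∏ j, (L j : ℝ) else 0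
    with hg
  have hg0 : ∀ y u, 0 ≤ g y u := fun y u =>
    Finset.sum_nonneg fun w _ => by split_ifs <;> positivity
  have hgsum : ∑ x : (Fin n → α) × (Fin K × Fin (L i)), g x.1 x.2 = 1 := by
    rw [Fintype.sum_prod_type, ← sum_div_prod_eq_one hL, Finset.sum_comm]
    simp only [hg, Fintype.sum_prod_type]
    have h1 : ∀ m (v : Fin (L i)), ∑ y : Fin n → α, ∑ w : (∀ j, Fin (L j)),
        (if w i = v then (c.coordinator w m).toReal * (c.kernel j m (w j) y).toReal /
          ∏ j, (L j : ℝ) else 0) =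
        ∑ w : (∀ j, Fin (L j)),
          if w i = v then (c.coordinator w m).toReal / ∏ j, (L j : ℝ) else 0 := by
      intro m v
      rw [Finset.sum_comm]
      refine Finset.sum_congr rfl fun w _ => ?_
      split_ifs
      · rw [← Finset.sum_div, ← Finset.mul_sum, PMF.sum_toReal_eq_one, mul_one]
      · simp
    simp only [h1]
    have h2 : ∀ m, ∑ v : Fin (L i), ∑ w : (∀ j, Fin (L j)),
        (if w i = v then (c.coordinator w m).toReal / ∏ j, (L j : ℝ) else 0) =
        ∑ w : (∀ j, Fin (L j)), (c.coordinator w m).toReal / ∏ j, (L j : ℝ) := by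
      intro m
      rw [Finset.sum_comm]
      simp
    simp only [h2]
    rw [Finset.sum_comm]
    simp only [← Finset.sum_div, PMF.sum_toReal_eq_one]
  -- Only the output factors of processors `i` and `j` are kept; all others are bounded by 1.
  have hle : ∀ y : Fin n → α, c.induced (fun _ => y) ≤
      ∑ u : Fin K × Fin (L i), (c.kernel i u.1 u.2 y).toReal * g y u := by
    intro y
    rw [induced_eq, Finset.sum_comm, Fintype.sum_prod_type]
    refine Finset.sum_le_sum fun m _ => ?_
    simp only [hg, Finset.mul_sum]
    rw [Finset.sum_comm]
    refine Finset.sum_le_sum fun w _ => ?_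
    simp only [mul_ite, mul_zero, Finset.sum_ite_eq, Finset.mem_univ, if_true]
    rw [← mul_div_assoc, mul_left_comm]
    gcongr
    rw [← Finset.mul_prod_erase _ _ (Finset.mem_univ i),
      ← Finset.mul_prod_erase _ _ (Finset.mem_erase.2 ⟨hij.symm, Finset.mem_univ j⟩)]
    gcongr
    exact mul_le_of_le_one_right ENNReal.toReal_nonneg (Finset.prod_le_one
      (fun _ _ => ENNReal.toReal_nonneg) fun _ _ => PMF.toReal_apply_le_one _ _)
  -- Interpolation with weight 1/2 prepares Cauchy–Schwarz: `g` has total mass 1, while the kernels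
  -- of processor `i` have total mass `K * L i`, one unit per observation.
  calc ∑ y : Fin n → α, min b (c.induced fun _ => y)
      ≤ ∑ y : Fin n → α, ∑ u : Fin K × Fin (L i),
          √(b * (c.kernel i u.1 u.2 y).toReal) * √(g y u) := by
        refine Finset.sum_le_sum fun y _ => ?_
        refine (min_le_min_left b (hle y)).trans ?_
        refine (min_sum_le_sum_min _ hb fun u _ =>
          mul_nonneg ENNReal.toReal_nonneg (hg0 y u)).trans ?_
        refine Finset.sum_le_sum fun u _ => ?_
        have h := min_le_rpow_mul_rpow (s := 1 / 2) hb
          (mul_nonneg (ENNReal.toReal_nonneg (a := c.kernel i u.1 u.2 y)) (hg0 y u))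
          (by norm_num) (by norm_num)
        rw [← Real.sqrt_mul (by positivity), mul_assoc, Real.sqrt_mul hb, Real.sqrt_eq_rpow,
          Real.sqrt_eq_rpow]
        rwa [show (1 : ℝ) - 1 / 2 = 1 / 2 by norm_num] at h
    _ = ∑ x : (Fin n → α) × (Fin K × Fin (L i)),
          √(b * (c.kernel i x.2.1 x.2.2 x.1).toReal) * √(g x.1 x.2) := by
        rw [Fintype.sum_prod_type]
    _ ≤ √(∑ x : (Fin n → α) × (Fin K × Fin (L i)), b * (c.kernel i x.2.1 x.2.2 x.1).toReal) *
          √(∑ x : (Fin n → α) × (Fin K × Fin (L i)), g x.1 x.2) :=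
        Real.sum_sqrt_mul_sqrt_le _ (fun x => by positivity) (fun x => hg0 _ _)
    _ = √(b * (K * L i)) := by
        rw [hgsum, Real.sqrt_one, mul_one, Fintype.sum_prod_type, Finset.sum_comm]
        simp only [← Finset.mul_sum, PMF.sum_toReal_eq_one]
        simp

end SimulationCode

/-! ### Rounding of rates and limits of exponentials -/

theorem sum_comp_le_sum_of_injective {ι κ : Type*} [Fintype ι] [Fintype κ] {e : ι → κ}
    (he : Function.Injective e) {f : κ → ℝ} (hf : ∀ k, 0 ≤ f k) : ∑ i, f (e i) ≤ ∑ k, f k := by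
  have h := Finset.sum_map Finset.univ ⟨e, he⟩ f
  simp only [Function.Embedding.coeFn_mk] at h
  rw [← h]
  exact Finset.sum_le_univ_sum_of_nonneg hf

theorem indexSize_pos (n : ℕ) {R : ℝ} (hR : 0 ≤ R) : 0 < indexSize n R :=
  Nat.floor_pos.2 (Real.one_le_rpow (by norm_num) (by positivity))

theorem indexSize_le (n : ℕ) (R : ℝ) : (indexSize n R : ℝ) ≤ 2 ^ (n * R) :=
  Nat.floor_le (by positivity)

theorem half_le_indexSize (n : ℕ) {R : ℝ} (hR : 0 ≤ R) :
    (2 : ℝ) ^ (n * R) / 2 ≤ indexSize n R := by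
  have h1 : (1 : ℝ) ≤ indexSize n R := by exact_mod_cast indexSize_pos n hR
  have h2 : (2 : ℝ) ^ (n * R) < indexSize n R + 1 := Nat.lt_floor_add_one _
  linarith

theorem tendsto_two_rpow_nat_mul {e : ℝ} (he : e < 0) :
    Filter.Tendsto (fun n : ℕ => (2 : ℝ) ^ (n * e)) Filter.atTop (nhds 0) := by
  have h := tendsto_pow_atTop_nhds_zero_of_lt_one (r := (2 : ℝ) ^ e) (by positivity)
    (Real.rpow_lt_one_of_one_lt_of_neg (by norm_num) he)
  refine h.congr fun n => ?_
  rw [← Real.rpow_natCast, ← Real.rpow_mul (by norm_num), mul_comm]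

theorem sum_iidLaw {t : ℕ} {α : Type*} [Fintype α] (q : PMF (Fin t → α)) (n : ℕ) :
    ∑ x : Fin t → Fin n → α, iidLaw (A := fun _ => α) q n x = 1 := by
  rw [← sum_prodLaw q n]
  exact Fintype.sum_equiv (Equiv.piComm _) _ _ fun x => rfl

/-! ### Reduction to the diagonal and the converse -/

section Diagonal

variable {t : ℕ} {α : Type*} {q : PMF (Fin t → α)} {p : PMF α}

theorem apply_const_eq (i : Fin t) (hq : ∀ x ∈ q.support, ∀ i j : Fin t, x i = x j)
    (hp : q.map (fun x => x i) = p) (a : α) : q (fun _ => a) = p a := by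
  classical
  rw [← hp, PMF.map_apply, tsum_eq_single (fun _ => a)]
  · simp
  · intro x hx
    by_contra h
    obtain ⟨rfl, hx0⟩ : a = x i ∧ q x ≠ 0 := by
      by_contra h'
      apply h
      split_ifs with ha
      · exact not_not.1 fun h0 => h' ⟨ha, h0⟩
      · rfl
    exact hx (funext fun j => hq x ((q.mem_support_iff x).2 hx0) j i)

theorem iidLaw_diag (i : Fin t) (hq : ∀ x ∈ q.support, ∀ i j : Fin t, x i = x j)
    (hp : q.map (fun x => x i) = p) (n : ℕ) (y : Fin n → α) :
    iidLaw (A := fun _ => α) q n (fun _ => y) = prodLaw p n y :=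
  Finset.prod_congr rfl fun k _ => congrArg ENNReal.toReal (apply_const_eq i hq hp (y k))

theorem iidLaw_eq_zero (i : Fin t) (hq : ∀ x ∈ q.support, ∀ i j : Fin t, x i = x j) (n : ℕ)
    {x : Fin t → Fin n → α} (hx : x ∉ Set.range fun (y : Fin n → α) (_ : Fin t) => y) :
    iidLaw (A := fun _ => α) q n x = 0 := by
  by_contra h
  refine hx ⟨x i, funext fun j => funext fun k => ?_⟩
  have hk := Finset.prod_ne_zero_iff.1 h k (Finset.mem_univ k)
  exact hq _ ((q.mem_support_iff _).2 fun h0 => hk (by rw [h0, ENNReal.toReal_zero])) i j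

theorem const_injective {β : Type*} (i : Fin t) :
    Function.Injective fun (y : β) (_ : Fin t) => y :=
  fun _ _ h => congrFun h i

variable [Fintype α]

/-- Pointwise on the diagonal, Q ≤ (Q - b)⁺ + min(b, P) + |P - Q|; summing over y gives 1 on the
left. -/
theorem one_le_sum_max_add_sum_min_add (i : Fin t)
    (hq : ∀ x ∈ q.support, ∀ i j : Fin t, x i = x j) (hp : q.map (fun x => x i) = p) {n : ℕ}
    (P : (Fin t → Fin n → α) → ℝ) (b : ℝ) :
    1 ≤ (∑ y, max (prodLaw p n y - b) 0) + (∑ y : Fin n → α, min b (P fun _ => y)) +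
      ∑ x, |P x - iidLaw (A := fun _ => α) q n x| := by
  have h := sum_comp_le_sum_of_injective (const_injective (β := Fin n → α) i)
    (f := fun x => |P x - iidLaw (A := fun _ => α) q n x|) fun _ => abs_nonneg _
  refine le_trans ?_ (add_le_add_right h _)
  rw [← Finset.sum_add_distrib, ← Finset.sum_add_distrib, ← sum_prodLaw p n]
  refine Finset.sum_le_sum fun y _ => ?_
  rw [iidLaw_diag i hq hp]
  have h1 := le_max_left (prodLaw p n y - b) 0
  have h2 := le_max_right (prodLaw p n y - b) 0
  have h3 := neg_abs_le (P (fun _ => y) - prodLaw p n y)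
  have h4 := abs_nonneg (P (fun _ => y) - prodLaw p n y)
  rcases min_choice b (P fun _ => y) with h5 | h5 <;> rw [h5] <;> linarith

/-- Two laws of equal mass are at ℓ¹ distance twice the sum of the positive part of their
difference. The target vanishes off the diagonal, so its excess over `P` lives on the diagonal. -/
theorem sum_abs_sub_iidLaw_le (i : Fin t) (hq : ∀ x ∈ q.support, ∀ i j : Fin t, x i = x j)
    (hp : q.map (fun x => x i) = p) {n : ℕ}
    {P : (Fin t → Fin n → α) → ℝ} (hP : ∀ x, 0 ≤ P x) (hP1 : ∑ x, P x = 1) :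
    ∑ x, |P x - iidLaw (A := fun _ => α) q n x| ≤
      2 * ∑ y, max (prodLaw p n y - P fun _ => y) 0 := by
  have h := Fintype.sum_of_injective _ (const_injective (β := Fin n → α) i)
    (fun y => max (prodLaw p n y - P fun _ => y) 0)
    (fun x => max (iidLaw (A := fun _ => α) q n x - P x) 0)
    (fun x hx => by simp [iidLaw_eq_zero i hq n hx, hP x])
    (fun y => by simp [iidLaw_diag i hq hp])
  rw [h]
  have habs : ∀ u v : ℝ, |u - v| = (u - v) + 2 * max (v - u) 0 := by
    intro u v
    rcases le_total u v with huv | huv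
    · rw [abs_of_nonpos (by linarith), max_eq_left (by linarith)]; ring
    · rw [abs_of_nonneg (by linarith), max_eq_right (by linarith)]; ring
  simp only [habs, Finset.sum_add_distrib, Finset.sum_sub_distrib, hP1, sum_iidLaw, sub_self,
    zero_add, ← Finset.mul_sum, le_refl]

/-- With a negative exponent, the tail mass, the capped sum and the simulation error would all
vanish, although together they are at least 1. -/
theorem exponent_nonneg_of_tendsto (i : Fin t)
    (hq : ∀ x ∈ q.support, ∀ i j : Fin t, x i = x j) (hp : q.map (fun x => x i) = p)
    (P : ∀ n, (Fin t → Fin n → α) → ℝ)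
    (hP : Filter.Tendsto (fun n => ∑ x, |P n x - iidLaw (A := fun _ => α) q n x|)
      Filter.atTop (nhds 0)) {c e : ℝ} (hc : c < entropyBits p)
    (hmin : ∀ n : ℕ, ∑ y : Fin n → α, min ((2 : ℝ) ^ (-(n * c))) (P n fun _ => y) ≤
      (2 : ℝ) ^ (n * e)) : 0 ≤ e := by
  by_contra! he
  have h := ((tendsto_sum_max_prodLaw_sub p hc).add (tendsto_two_rpow_nat_mul he)).add hP
  simp only [add_zero] at h
  refine absurd (ge_of_tendsto' h fun n => ?_) (not_le.2 zero_lt_one)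
  exact (one_le_sum_max_add_sum_min_add i hq hp (P n) _).trans
    (add_le_add_left (add_le_add_right (hmin n) _) _)

theorem IsAchievable.entropyBits_le_message (ht : 2 ≤ t)
    (hq : ∀ x ∈ q.support, ∀ i j : Fin t, x i = x j) (hp : ∀ i, q.map (fun x => x i) = p)
    {R : ℝ} {Rs : Fin t → ℝ} (h : IsAchievable (individualAccess t) q R Rs) :
    ((t : ℝ) - 1) * entropyBits p / t ≤ R := by
  obtain ⟨hR, hRs, c, hc⟩ := h
  have ht2 : (2 : ℝ) ≤ t := by exact_mod_cast ht
  have hθ : (0 : ℝ) < 1 - 1 / t := by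
    rw [sub_pos, div_lt_one (by linarith)]; linarith
  have key : entropyBits p ≤ R / (1 - 1 / t) := by
    refine le_of_forall_lt_imp_le_of_dense fun e he => ?_
    rw [le_div_iff₀ hθ, ← sub_nonneg]
    refine exponent_nonneg_of_tendsto ⟨0, by omega⟩ hq (hp _) (fun n => (c n).induced) hc he
      fun n => ?_
    refine ((c n).sum_min_induced_le_message (by omega) (fun i => indexSize_pos n (hRs i))
      (by positivity)).trans ((mul_le_mul_of_nonneg_left (indexSize_le n R)
        (by positivity)).trans_eq ?_)
    rw [← Real.rpow_mul (by norm_num), ← Real.rpow_add (by norm_num)]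
    congr 1
    ring
  rw [le_div_iff₀ hθ] at key
  refine le_trans (le_of_eq ?_) key
  have ht0 : (t : ℝ) ≠ 0 := by linarith
  field_simp

theorem IsAchievable.entropyBits_le_add (ht : 2 ≤ t)
    (hq : ∀ x ∈ q.support, ∀ i j : Fin t, x i = x j) (hp : ∀ i, q.map (fun x => x i) = p)
    {R : ℝ} {Rs : Fin t → ℝ} (h : IsAchievable (individualAccess t) q R Rs) (i : Fin t) :
    entropyBits p ≤ R + Rs i := by
  obtain ⟨hR, hRs, c, hc⟩ := h
  obtain ⟨j, hj⟩ : ∃ j, j ≠ i :=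
    have : Nontrivial (Fin t) := Fin.nontrivial_iff_two_le.2 ht
    exists_ne i
  refine le_of_forall_lt_imp_le_of_dense fun e he => ?_
  -- The exponent is halved by the square root in the Cauchy–Schwarz bound.
  suffices 0 ≤ (R + Rs i - e) / 2 by linarith
  refine exponent_nonneg_of_tendsto i hq (hp _) (fun n => (c n).induced) hc he fun n => ?_
  refine ((c n).sum_min_induced_le_observation (fun i => indexSize_pos n (hRs i)) hj.symm
    (by positivity)).trans ?_
  refine Real.sqrt_le_iff.2 ⟨by positivity, ?_⟩
  calc (2 : ℝ) ^ (-(n * e)) * (indexSize n R * indexSize n (Rs i))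
      ≤ (2 : ℝ) ^ (-(n * e)) * (2 ^ (n * R) * 2 ^ (n * Rs i)) := by
        gcongr <;> exact indexSize_le _ _
    _ = ((2 : ℝ) ^ (n * ((R + Rs i - e) / 2))) ^ 2 := by
        rw [← Real.rpow_natCast, ← Real.rpow_mul (by norm_num), ← Real.rpow_add (by norm_num),
          ← Real.rpow_add (by norm_num)]
        congr 1
        push_cast
        ring

end Diagonal

/-! ### Construction of codes -/

/-- Reserve ⌊|Z| f(y)⌋ points of `Z` for each y; these blocks fit because `f` sums to 1. The
leftover points may go anywhere, since only a lower bound on fibers is needed. -/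
theorem exists_map_card_fiber_ge {Z β : Type*} [Fintype Z] [Fintype β] [DecidableEq β]
    [Nonempty β] {f : β → ℝ} (hf : ∀ y, 0 ≤ f y) (hf1 : ∑ y, f y = 1) :
    ∃ φ : Z → β, ∀ y, Fintype.card Z * f y - 1 ≤ ((Finset.univ.filter fun z => φ z = y).card : ℝ) := by
  set m : β → ℕ := fun y => ⌊Fintype.card Z * f y⌋₊
  have hm : Fintype.card (Σ y, Fin (m y)) ≤ Fintype.card Z := by
    rw [Fintype.card_sigma]
    simp only [Fintype.card_fin]
    have : ((∑ y, m y : ℕ) : ℝ) ≤ Fintype.card Z := by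
      push_cast
      calc ∑ y, (m y : ℝ) ≤ ∑ y, Fintype.card Z * f y :=
            Finset.sum_le_sum fun y _ => Nat.floor_le (mul_nonneg (Nat.cast_nonneg _) (hf y))
        _ = Fintype.card Z := by rw [← Finset.mul_sum, hf1, mul_one]
    exact_mod_cast this
  obtain ⟨e⟩ := Function.Embedding.nonempty_of_card_le hm
  refine ⟨Function.extend e Sigma.fst fun _ => Classical.arbitrary β, fun y => ?_⟩
  have h : m y ≤ (Finset.univ.filter fun z =>
      Function.extend e Sigma.fst (fun _ => Classical.arbitrary β) z = y).card := by
    rw [← Fintype.card_fin (m y), ← Finset.card_univ]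
    refine Finset.card_le_card_of_injOn (fun k => e ⟨y, k⟩) (fun k _ => ?_) fun k _ l _ hkl => ?_
    · simp [e.injective.extend_apply]
    · simpa using e.injective hkl
  have h1 : (m y : ℝ) ≤ _ := Nat.cast_le.2 h
  have h2 : Fintype.card Z * f y < m y + 1 := Nat.lt_floor_add_one _
  linarith

theorem exists_map_fin_card_fiber_ge (a : ℕ) {G : Type*} [Fintype G] [DecidableEq G]
    [Nonempty G] : ∃ π : Fin a → G, ∀ g,
      a / Fintype.card G ≤ (Finset.univ.filter fun w => π w = g).card := by
  have hm : Fintype.card (G × Fin (a / Fintype.card G)) ≤ Fintype.card (Fin a) := by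
    simpa using Nat.mul_div_le a (Fintype.card G)
  obtain ⟨e⟩ := Function.Embedding.nonempty_of_card_le hm
  refine ⟨Function.extend e Prod.fst fun _ => Classical.arbitrary G, fun g => ?_⟩
  conv_lhs => rw [← Fintype.card_fin (a / Fintype.card G), ← Finset.card_univ]
  refine Finset.card_le_card_of_injOn (fun k => e (g, k)) (fun k _ => ?_) fun k _ l _ hkl => ?_
  · simp [e.injective.extend_apply]
  · simpa using e.injective hkl

theorem PMF.sum_map_toReal_mul {β γ : Type*} [Fintype β] [Fintype γ] (p : PMF β) (f : β → γ)
    (h : γ → ℝ) : ∑ c, (p.map f c).toReal * h c = ∑ b, (p b).toReal * h (f b) := by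
  classical
  have h1 : ∀ c, (p.map f c).toReal = ∑ b, if c = f b then (p b).toReal else 0 := by
    intro c
    rw [PMF.map_apply, tsum_fintype, ENNReal.toReal_sum fun b _ => by
      split_ifs
      · exact p.apply_ne_top b
      · exact ENNReal.zero_ne_top]
    refine Finset.sum_congr rfl fun b _ => ?_
    split_ifs <;> simp
  simp only [h1, Finset.sum_mul]
  rw [Finset.sum_comm]
  simp

/-- The coordinator reveals the differences `π j (w j) - π i₀ (w i₀)` together with a uniform
variable; every processor recovers the whole tuple `(π j (w j))` from its own source, and outputs
a function `φ` of it and of the uniform variable. -/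
theorem exists_code_induced_diag_ge {t n K : ℕ} {α G U : Type*} [AddCommGroup G] [Fintype G]
    [DecidableEq G] [Fintype U] [Nonempty U] [DecidableEq α] {L : Fin t → ℕ} (i₀ : Fin t)
    {π : ∀ i, Fin (L i) → G} {k : Fin t → ℕ}
    (hk : ∀ i g, k i ≤ (Finset.univ.filter fun w => π i w = g).card)
    (hK : Fintype.card G ^ (t - 1) * Fintype.card U ≤ K) (φ : (Fin t → G) × U → Fin n → α) :
    ∃ c : SimulationCode (individualAccess t) (fun _ => α) n K L, ∀ y,
      ((Finset.univ.filter fun z => φ z = y).card : ℝ) *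
        ((∏ i, (k i : ℝ)) / (Fintype.card U * ∏ i, (L i : ℝ))) ≤ c.induced fun _ => y := by
  have hcard : Fintype.card (({j : Fin t // j ≠ i₀} → G) × U) ≤ Fintype.card (Fin K) := by
    simpa [Fintype.card_subtype_compl] using hK
  obtain ⟨e⟩ := Function.Embedding.nonempty_of_card_le hcard
  set diff : (∀ j, Fin (L j)) → {j : Fin t // j ≠ i₀} → G :=
    fun w j => π j (w j) - π i₀ (w i₀)
  -- The coordinate `i₀` is not transmitted; its difference with itself is 0.
  set ext : ({j : Fin t // j ≠ i₀} → G) → Fin t → G :=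
    fun z j => if h : j = i₀ then 0 else z ⟨j, h⟩
  have hext : ∀ w j, ext (diff w) j = π j (w j) - π i₀ (w i₀) := by
    intro w j
    by_cases h : j = i₀
    · subst h; simp [ext]
    · simp [ext, diff, h]
  let c : SimulationCode (individualAccess t) (fun _ => α) n K L :=
    { coordinator := fun w => (PMF.uniformOfFintype U).map fun u => e (diff w, u)
      processor := fun i m v =>
        -- Messages outside the range of `e` are never sent, so the arbitrary value of `invFun`
        -- there is harmless. Below, own hash minus own difference recovers the hash of source `i₀`,
        -- and adding the `j`-th difference yields that of source `j`.
        let z := Function.invFun e m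
        PMF.pure (φ (fun j => π i (v ⟨i, Finset.mem_singleton_self i⟩) - ext z.1 i + ext z.1 j,
          z.2)) }
  have hproc : ∀ i w u, c.processor i (e (diff w, u)) (fun j => w j) =
      PMF.pure (φ (fun j => π j (w j), u)) := by
    intro i w u
    simp only [c, Function.leftInverse_invFun e.injective _, hext]
    congr 3
    funext j
    abel
  refine ⟨c, fun y => ?_⟩
  have hind : c.induced (fun _ => y) = ∑ w : (∀ j, Fin (L j)), ∑ u : U,
      (if φ (fun j => π j (w j), u) = y then
        1 / (Fintype.card U * ∏ i, (L i : ℝ)) else 0) := by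
    refine Finset.sum_congr rfl fun w _ => ?_
    simp only [mul_div_assoc]
    rw [PMF.sum_map_toReal_mul]
    refine Finset.sum_congr rfl fun u _ => ?_
    rw [Finset.prod_congr rfl fun i _ => by rw [hproc i w u]]
    simp only [PMF.pure_apply, PMF.uniformOfFintype_apply, Finset.prod_const, Finset.card_univ,
      Fintype.card_fin]
    -- A wrong output must contribute 0, which requires the product of point masses to be nonempty.
    have ht : t ≠ 0 := fun h => by subst h; exact i₀.elim0
    by_cases h : φ (fun j => π j (w j), u) = y
    · simp [h, mul_comm]
    · simp [h, Ne.symm h, ht]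
  have hfib : ∀ g : Fin t → G, (∏ i, (k i : ℝ)) ≤
      ((Finset.univ.filter fun w : (∀ j, Fin (L j)) => (fun j => π j (w j)) = g).card : ℝ) := by
    intro g
    have : (Finset.univ.filter fun w : (∀ j, Fin (L j)) => (fun j => π j (w j)) = g) =
        Fintype.piFinset fun i => Finset.univ.filter fun w => π i w = g i := by
      ext w
      simp [funext_iff]
    rw [this, Fintype.card_piFinset]
    push_cast
    exact Finset.prod_le_prod (fun _ _ => Nat.cast_nonneg _) fun i _ => by exact_mod_cast hk i (g i)
  rw [hind, ← Finset.sum_fiberwise' Finset.univ (fun w : (∀ j, Fin (L j)) => fun j => π j (w j))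
    fun g => ∑ u : U, (if φ (g, u) = y then 1 / (Fintype.card U * ∏ i, (L i : ℝ)) else 0)]
  have hcount : ((Finset.univ.filter fun z => φ z = y).card : ℝ) =
      ∑ g, ∑ u : U, if φ (g, u) = y then 1 else 0 := by
    rw [Finset.card_filter, Fintype.sum_prod_type]
    push_cast
    rfl
  rw [hcount, Finset.sum_mul]
  refine Finset.sum_le_sum fun g _ => ?_
  rw [Finset.sum_const, nsmul_eq_mul, div_eq_mul_one_div (∏ i, (k i : ℝ)), mul_left_comm,
    Finset.sum_mul]
  simp only [ite_mul, one_mul, zero_mul]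
  exact mul_le_mul_of_nonneg_right (hfib g) (Finset.sum_nonneg fun u _ => by
    split_ifs <;> positivity)

/-- Two losses occur: the first term is the source mass lost when the hash fibers are rounded down
to equal size, the second is the error of quantizing Q with `l ^ t * N` equally likely points. -/
theorem exists_code_sum_abs_le {t : ℕ} {α : Type*} [Fintype α] {q : PMF (Fin t → α)} {p : PMF α}
    (i : Fin t) (hq : ∀ x ∈ q.support, ∀ i j : Fin t, x i = x j)
    (hp : q.map (fun x => x i) = p) (n : ℕ) {K l N : ℕ} {L : Fin t → ℕ} (hL : ∀ i, 0 < L i)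
    (hl : 0 < l) (hN : 0 < N) (hK : l ^ (t - 1) * N ≤ K) :
    ∃ c : SimulationCode (individualAccess t) (fun _ => α) n K L,
      ∑ x, |c.induced x - iidLaw (A := fun _ => α) q n x| ≤
        2 * ((1 - ∏ i, ((l * (L i / l) : ℕ) : ℝ) / L i) +
          ∑ y, min (prodLaw p n y) (1 / ((l : ℝ) ^ t * N))) := by
  classical
  have : NeZero l := ⟨hl.ne'⟩
  have : NeZero N := ⟨hN.ne'⟩
  have : Nonempty α := ⟨p.support_nonempty.some⟩
  choose π hπ using fun i => exists_map_fin_card_fiber_ge (L i) (G := Fin l)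
  obtain ⟨φ, hφ⟩ := exists_map_card_fiber_ge (Z := (Fin t → Fin l) × Fin N)
    (prodLaw_nonneg p n) (sum_prodLaw p n)
  obtain ⟨c, hc⟩ := exists_code_induced_diag_ge (U := Fin N) i hπ (by simpa using hK) φ
  refine ⟨c, (sum_abs_sub_iidLaw_le i hq hp c.induced_nonneg (c.sum_induced hL)).trans ?_⟩
  gcongr
  set η : ℝ := ∏ i, ((l * (L i / l) : ℕ) : ℝ) / L i with hη
  have hη0 : 0 ≤ η := Finset.prod_nonneg fun _ _ => by positivity
  have hη1 : η ≤ 1 := Finset.prod_le_one (fun _ _ => by positivity) fun i _ =>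
    div_le_one_of_le₀ (by exact_mod_cast Nat.mul_div_le (L i) l) (Nat.cast_nonneg _)
  have hD : (0 : ℝ) < (l : ℝ) ^ t * N := by positivity
  have hηeq : (∏ i, ((L i / l : ℕ) : ℝ)) / (N * ∏ i, (L i : ℝ)) = η / ((l : ℝ) ^ t * N) := by
    have hlt : (l : ℝ) ^ t ≠ 0 := by positivity
    rw [hη, Finset.prod_div_distrib]
    push_cast
    rw [Finset.prod_mul_distrib, Finset.prod_const, Finset.card_univ, Fintype.card_fin]
    have : (∏ i, (L i : ℝ)) ≠ 0 := Finset.prod_ne_zero_iff.2 fun i _ => by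
      exact_mod_cast (hL i).ne'
    field_simp
  have hs : (1 - η) = ∑ y, (1 - η) * prodLaw p n y := by
    rw [← Finset.mul_sum, sum_prodLaw, mul_one]
  rw [hs, ← Finset.sum_add_distrib]
  refine Finset.sum_le_sum fun y _ => ?_
  have hQ := prodLaw_nonneg p n y
  have hφy := hφ y
  have hcy := hc y
  simp only [Fintype.card_fin, Fintype.card_prod, Fintype.card_pi, Finset.prod_const,
    Finset.card_univ, Nat.cast_mul, Nat.cast_pow] at hφy hcy
  rw [hηeq] at hcy
  have hlow : η * (prodLaw p n y - 1 / ((l : ℝ) ^ t * N)) ≤ c.induced fun _ => y := by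
    refine le_trans ?_ hcy
    refine le_trans (le_of_eq ?_)
      (mul_le_mul_of_nonneg_right hφy (div_nonneg hη0 hD.le))
    field_simp
  have hpos := c.induced_nonneg fun _ => y
  have hd : (0 : ℝ) ≤ 1 / ((l : ℝ) ^ t * N) := by positivity
  set d : ℝ := 1 / ((l : ℝ) ^ t * N)
  refine max_le ?_ (add_nonneg (mul_nonneg (by linarith) hQ) (le_min hQ hd))
  -- Below `d` the trivial bound P ≥ 0 suffices; above it the fiber bound η(Q - d) ≤ P is used.
  rcases le_total (prodLaw p n y) d with h | h
  · rw [min_eq_left h]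
    nlinarith
  · rw [min_eq_right h]
    nlinarith

/-- The remainder of the division is less than the divisor, which is exponentially smaller than the
dividend because `a < b`. -/
theorem tendsto_mul_div_indexSize {a b : ℝ} (ha : 0 ≤ a) (hab : a < b) :
    Filter.Tendsto (fun n : ℕ =>
      ((indexSize n a * (indexSize n b / indexSize n a) : ℕ) : ℝ) / indexSize n b)
      Filter.atTop (nhds 1) := by
  have hb : 0 ≤ b := ha.trans hab.le
  have h := ((tendsto_two_rpow_nat_mul (sub_neg.2 hab)).const_mul 2).const_sub 1
  rw [mul_zero, sub_zero] at h
  refine tendsto_of_tendsto_of_tendsto_of_le_of_le h tendsto_const_nhds (fun n => ?_) fun n => ?_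
  · have hpos : (0 : ℝ) < indexSize n b := by exact_mod_cast indexSize_pos n hb
    have h1 : (indexSize n b : ℝ) ≤
        ((indexSize n a * (indexSize n b / indexSize n a) : ℕ) : ℝ) + indexSize n a := by
      have h2 := Nat.div_add_mod (indexSize n b) (indexSize n a)
      have h3 := Nat.mod_lt (indexSize n b) (indexSize_pos n ha)
      exact_mod_cast (by omega : indexSize n b ≤
        indexSize n a * (indexSize n b / indexSize n a) + indexSize n a)
    have h4 : (indexSize n a : ℝ) ≤ 2 * (2 : ℝ) ^ (n * (a - b)) * indexSize n b := by
      calc (indexSize n a : ℝ) ≤ 2 ^ (n * a) := indexSize_le n a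
        _ = 2 * (2 : ℝ) ^ (n * (a - b)) * (2 ^ (n * b) / 2) := by
          rw [show (n : ℝ) * a = n * (a - b) + n * b by ring, Real.rpow_add (by norm_num)]
          ring
        _ ≤ _ := by
          gcongr
          exact half_le_indexSize n hb
    simp only
    rw [le_div_iff₀ hpos]
    linarith
  · exact div_le_one_of_le₀ (Nat.cast_le.2 (Nat.mul_div_le _ _)) (Nat.cast_nonneg _)

/-! ### Choice of rates and the region -/

section Region

variable {t : ℕ} {α : Type*} [Fintype α] {q : PMF (Fin t → α)} {p : PMF α}

/-- Here `a` is the rate of the hash group and `b` that of the fresh randomness: the message costs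
(t-1)a + b, the shared randomness amounts to ta + b. -/
theorem isAchievable_of_lt (i : Fin t) (hq : ∀ x ∈ q.support, ∀ i j : Fin t, x i = x j)
    (hp : q.map (fun x => x i) = p) {R a b : ℝ} {Rs : Fin t → ℝ} (ha : 0 ≤ a) (hb : 0 ≤ b)
    (haR : ∀ i, a < Rs i) (hR : ((t : ℝ) - 1) * a + b = R) (hH : entropyBits p < t * a + b) :
    IsAchievable (individualAccess t) q R Rs := by
  have ht : (1 : ℝ) ≤ t := by exact_mod_cast i.pos
  have hRs : ∀ i, 0 ≤ Rs i := fun i => ha.trans (haR i).le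
  have hK : ∀ n, indexSize n a ^ (t - 1) * indexSize n b ≤ indexSize n R := by
    intro n
    refine Nat.le_floor ?_
    push_cast
    calc (indexSize n a : ℝ) ^ (t - 1) * indexSize n b
        ≤ ((2 : ℝ) ^ (n * a)) ^ (t - 1) * 2 ^ (n * b) := by
          gcongr <;> exact indexSize_le _ _
      _ = 2 ^ (n * R) := by
          rw [← Real.rpow_natCast, ← Real.rpow_mul (by norm_num), ← Real.rpow_add (by norm_num),
            Nat.cast_sub i.pos, ← hR]
          congr 1
          push_cast
          ring
  choose c hc using fun n => exists_code_sum_abs_le i hq hp n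
    (fun i => indexSize_pos n (hRs i)) (indexSize_pos n ha) (indexSize_pos n hb) (hK n)
  refine ⟨by rw [← hR]; exact add_nonneg (mul_nonneg (by linarith) ha) hb, hRs, c,
    squeeze_zero (fun n => Finset.sum_nonneg fun _ _ => abs_nonneg _) hc ?_⟩
  have h1 := tendsto_finsetProd (Finset.univ : Finset (Fin t)) fun i _ =>
    tendsto_mul_div_indexSize ha (haR i)
  rw [Finset.prod_const_one] at h1
  have h2 : Filter.Tendsto (fun n : ℕ => ∑ y, min (prodLaw p n y)
      (1 / ((indexSize n a : ℝ) ^ t * indexSize n b))) Filter.atTop (nhds 0) := by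
    -- Each of the `t + 1` rounded factors loses at most a factor 2.
    have h := (tendsto_sum_min_prodLaw p hH).const_mul ((2 : ℝ) ^ (t + 1))
    rw [mul_zero] at h
    refine squeeze_zero (fun n => Finset.sum_nonneg fun y _ =>
      le_min (prodLaw_nonneg p n y) (by positivity)) (fun n => ?_) h
    have hd : 1 / ((indexSize n a : ℝ) ^ t * indexSize n b) ≤
        (2 : ℝ) ^ (t + 1) * (2 : ℝ) ^ (-(n * (t * a + b))) := by
      calc 1 / ((indexSize n a : ℝ) ^ t * indexSize n b)
          ≤ 1 / (((2 : ℝ) ^ (n * a) / 2) ^ t * (2 ^ (n * b) / 2)) := by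
            gcongr
            · exact half_le_indexSize n ha
            · exact half_le_indexSize n hb
        _ = _ := by
            rw [Real.rpow_neg (by norm_num), div_pow, ← Real.rpow_natCast (2 ^ (n * a) : ℝ),
              ← Real.rpow_mul (by norm_num),
              show (n : ℝ) * (t * a + b) = n * a * t + n * b by ring,
              Real.rpow_add (by norm_num), pow_succ]
            field_simp
    rw [Finset.mul_sum]
    refine Finset.sum_le_sum fun y _ => ?_
    rw [mul_min_of_nonneg _ _ (by positivity)]
    refine min_le_min ?_ hd
    exact le_mul_of_one_le_left (prodLaw_nonneg p n y) (one_le_pow₀ (by norm_num))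
  simpa using ((h1.const_sub 1).add h2).const_mul 2

theorem entropyBits_nonneg (p : PMF α) : 0 ≤ entropyBits p := by
  rw [entropyBits, ← Finset.sum_neg_distrib]
  refine Finset.sum_nonneg fun a _ => ?_
  rw [← mul_neg]
  exact mul_nonneg ENNReal.toReal_nonneg (neg_nonneg.2
    (Real.logb_nonpos (by norm_num) ENNReal.toReal_nonneg (p.toReal_apply_le_one a)))

theorem isAchievable_add (i : Fin t) (hq : ∀ x ∈ q.support, ∀ i j : Fin t, x i = x j)
    (hp : q.map (fun x => x i) = p) {R : ℝ} {Rs : Fin t → ℝ} (hRs : ∀ i, 0 ≤ Rs i)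
    (hH : entropyBits p ≤ R + ⨅ i, Rs i) (hR : ((t : ℝ) - 1) * entropyBits p / t ≤ R)
    {ε : ℝ} (hε : 0 < ε) :
    IsAchievable (individualAccess t) q (R + ε) fun i => Rs i + ε := by
  have : Nonempty (Fin t) := ⟨i⟩
  have ht : (1 : ℝ) ≤ t := by exact_mod_cast i.pos
  -- The hash rate cannot exceed any source rate, and beyond H(X)/t it is not needed. The two
  -- arguments of the minimum match the two constraints of the region: either one yields H(X) ≤ R +
  -- a. The slack ε then makes both `a < Rs i + ε` and H(X) < ta + b = R + ε + a strict.
  set a := min (⨅ i, Rs i) (entropyBits p / t) with ha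
  have haH : a ≤ entropyBits p / t := min_le_right _ _
  have h1 : ((t : ℝ) - 1) * a ≤ R :=
    (mul_le_mul_of_nonneg_left haH (by linarith)).trans (by rwa [← mul_div_assoc])
  have h2 : entropyBits p ≤ R + a := by
    rcases min_choice (⨅ i, Rs i) (entropyBits p / t) with h | h <;> rw [ha, h]
    · exact hH
    · refine le_trans (le_of_eq ?_) (add_le_add_left hR _)
      field_simp
      ring
  refine isAchievable_of_lt i hq hp (a := a) (b := R + ε - ((t : ℝ) - 1) * a)
    (le_min (le_ciInf hRs) (div_nonneg (entropyBits_nonneg p) (by linarith))) (by linarith)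
    (fun j => ?_) (by ring) (by linarith)
  have : a ≤ Rs j := (min_le_left _ _).trans (ciInf_le (Set.finite_range Rs).bddBelow j)
  linarith

end Region

/-- All outputs are equal under `q` (`hq`), and `p` is the law of the common value `X` (`hp`). -/
theorem mainTheorem8 {t : ℕ} (ht : 2 ≤ t) {α : Type*} [Fintype α]
    (q : PMF (Fin t → α)) (hq : ∀ x ∈ q.support, ∀ i j : Fin t, x i = x j)
    (p : PMF α) (hp : ∀ i : Fin t, q.map (fun x => x i) = p) :
    simulationRegion (individualAccess t) q =
      {r : ℝ × (Fin t → ℝ) | 0 ≤ r.1 ∧ (∀ i, 0 ≤ r.2 i) ∧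
        entropyBits p ≤ (r.1 + (⨅ i, r.2 i)) ∧
        ((t : ℝ) - 1) * entropyBits p / (t : ℝ) ≤ r.1} := by
  have i : Fin t := ⟨0, by omega⟩
  have : Nonempty (Fin t) := ⟨i⟩
  refine Set.Subset.antisymm ?_ ?_
  · have hinf : ∀ r : ℝ × (Fin t → ℝ),
        entropyBits p ≤ r.1 + (⨅ i, r.2 i) ↔ ∀ i, entropyBits p ≤ r.1 + r.2 i := by
      intro r
      rw [← sub_le_iff_le_add', le_ciInf_iff (Set.finite_range r.2).bddBelow]
      simp only [sub_le_iff_le_add']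
    simp only [hinf]
    refine closure_minimal (fun r hr => ⟨hr.1, hr.2.1, fun i => hr.entropyBits_le_add ht hq hp i,
      hr.entropyBits_le_message ht hq hp⟩) ?_
    simp only [Set.ofPred_and, Set.ofPred_forall]
    refine IsClosed.inter (isClosed_le (by fun_prop) (by fun_prop)) (IsClosed.inter
      (isClosed_iInter fun i => isClosed_le (by fun_prop) (by fun_prop)) (IsClosed.inter
      (isClosed_iInter fun i => isClosed_le (by fun_prop) (by fun_prop))
      (isClosed_le (by fun_prop) (by fun_prop))))
  · rintro ⟨R, Rs⟩ ⟨-, hRs, hH, hR⟩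
    -- Each point of the region is the limit, as ε decreases to 0, of achievable points with all
    -- rates raised by ε.
    have hcont : Continuous fun ε : ℝ => ((R + ε, fun i => Rs i + ε) : ℝ × (Fin t → ℝ)) := by
      fun_prop
    have h := (hcont.tendsto 0).mono_left (nhdsWithin_le_nhds (s := Set.Ioi 0))
    simp only [add_zero] at h
    exact mem_closure_of_tendsto h (eventually_nhdsWithin_of_forall fun ε hε =>
      isAchievable_add i hq (hp i) hRs hH hR hε)
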